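/- Let $n\ge 1$ and $0\le k\le n$, let $X$ be the set of $k$-subsets of $\{1,\dots,n\}$ (the vertices of the Johnson graph $J(n,k)$), and let $\mathcal F$ be the space of functions $X\to\mathbb C$ with the inner product for which the delta functions $\delta(x)$, $x\in X$, are orthonormal. The symmetric group $S_n$ acts on $\mathcal F$ by $\sigma f=f\circ\sigma^{-1}$; for $1\le j\le n$ let $S_j\subseteq S_n$ be the subgroup of the permutations that fix $j+1,\dots,n$. For $0\le i\le n$ consider the subspaces $$\mathcal F_{1,\lambda_1}\cap\dots\cap\mathcal F_{i,\lambda_i}\cap\mathcal F^{w},$$ where $\mathcal F_{j,\lambda_j}$ is an isotypic component of $\mathcal F$ as a representation of $S_j$, and, for a set $w\subseteq\{i+1,\dots,n\}$, $\mathcal F^w$ is the span of the $\delta(x)$ with $x\cap\{i+1,\dots,n\}=w$. Let $B_0$ be the basis of delta functions, put $B_1=B_0$, and for $1\le i\le n$ let $B_i$ be an orthonormal basis of $\mathcal F$, indexed by $X$, each of whose vectors lies in one of these subspaces (for the index $i$); thus $B_n$ is a Gelfand–Tsetlin basis of $\mathcal F$, and $B_1,\dots,B_{n-1}$ are the intermediate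 bases. Write $[b]_{b'}$ for the matrix whose columns are the coordinate vectors in $b'$ of the vectors of $b$, and $[f]_b$ for the coordinate vector of $f$ in $b$. Then: 1. Each of the above subspaces has dimension at most one (so that $B_i$ is determined up to order and scalars of modulus one), and such bases $B_0,\dots,B_n$ exist; they can be chosen so that all the matrices $[B_i]_{B_{i+1}}$, $1\le i<n$, are real orthogonal matrices. 2. For every choice of such bases, $$[B_0]_{B_n}=[B_{n-1}]_{B_n}\,[B_{n-2}]_{B_{n-1}}\cdots[B_1]_{B_2},$$ and each of the $n-1$ factors is unitary and has at most two nonzero entries in each column. 3. For every choice of such bases there is a straight-line computation, independent of $f$, that computes $[f]_{B_n}=[B_0]_{B_n}[f]_{B_0}$ from $[f]_{B_0}$ for every $f\in\mathcal F$ and that uses at most $2(n-1)\binom nk$ operations. Here one operation is one complex multiplication and addition $c\,u+v$, where $u,v$ are $0$, entries of the input, or results of earlier operations, and $c$ is an entry of one of the factors $[B_i]_{B_{i+1}}$, $1\le i<n$. -/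

import Mathlib

namespace JohnsonFFT

/-- The vertex set of the Johnson graph `J(n,k)`: the `k`-subsets of an `n`-set. A `k`-subset is
also read as a word of length `n` in the letters `1, 2`, with the letter `1` exactly at the places
that belong to the subset. -/
abbrev KSet (n k : ℕ) : Type := Set.powersetCard (Fin n) k

/-- The space of complex functions on the `k`-subsets, with the inner product for which the
delta functions are orthonormal. -/
abbrev FunSpace (n k : ℕ) : Type := EuclideanSpace ℂ (KSet n k)

/-- The basis of delta functions. -/
noncomputable def deltaBasis (n k : ℕ) : OrthonormalBasis (KSet n k) ℂ (FunSpace n k) :=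
  EuclideanSpace.basisFun (KSet n k) ℂ

/-- The action `σ f = f ∘ σ⁻¹` of the symmetric group. -/
noncomputable def permRep (n k : ℕ) :
    Representation ℂ (Equiv.Perm (Fin n)) (FunSpace n k) where
  toFun σ :=
    { toFun := fun f => WithLp.toLp 2 fun x => f (σ⁻¹ • x)
      map_add' := fun _ _ => rfl
      map_smul' := fun _ _ => rfl }
  map_one' := by
    ext f x
    simp
  map_mul' σ τ := by
    ext f x
    change f ((σ * τ)⁻¹ • x) = f (τ⁻¹ • σ⁻¹ • x)
    rw [mul_inv_rev, mul_smul]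

/-- The subgroup `S_j` of the permutations that fix all but the first `j` places. -/
def symSub (n j : ℕ) : Subgroup (Equiv.Perm (Fin n)) :=
  fixingSubgroup (Equiv.Perm (Fin n)) {m : Fin n | j ≤ (m : ℕ)}

/-- The function space as a representation of `S_j`. -/
noncomputable def subRep (n k j : ℕ) : Representation ℂ (symSub n j) (FunSpace n k) :=
  (permRep n k).comp (symSub n j).subtype

/-- The set of the (nonzero) isotypic components of the function space under `S_j`, as complex
subspaces. -/
def isotypicSpaces (n k j : ℕ) : Set (Submodule ℂ (FunSpace n k)) :=
  (fun C : Submodule (MonoidAlgebra ℂ (symSub n j)) (subRep n k j).asModule =>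
      (C.restrictScalars ℂ).map (subRep n k j).asModuleEquiv.toLinearMap) ''
    isotypicComponents (MonoidAlgebra ℂ (symSub n j)) (subRep n k j).asModule

/-- The subspace spanned by the delta functions of the words that agree with the word `w` at all
places after the first `i`. -/
noncomputable def suffixSpace (n k i : ℕ) (w : Finset (Fin n)) : Submodule ℂ (FunSpace n k) :=
  Submodule.span ℂ
    (deltaBasis n k '' {x | ∀ m : Fin n, i ≤ (m : ℕ) → (m ∈ (x : Finset (Fin n)) ↔ m ∈ w)})

/-- The intersection of `C 1, …, C i` with the subspace of the words ending like `w`; here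
`C j` will be an isotypic component under `S_j`. -/
noncomputable def gtSpace (n k i : ℕ) (C : ℕ → Submodule ℂ (FunSpace n k))
    (w : Finset (Fin n)) : Submodule ℂ (FunSpace n k) :=
  (⨅ j ∈ Finset.Icc 1 i, C j) ⊓ suffixSpace n k i w

/-- `b` is an `i`-th intermediate basis: every vector of the orthonormal basis `b` lies in one of
the subspaces `gtSpace` that are given by a choice of an isotypic component under each of
`S_1, …, S_i` and of the letters after place `i`. For `i = n` there is no condition on
letters, and `b` is a Gelfand–Tsetlin basis. -/
def IsGTBasis (n k i : ℕ) (b : OrthonormalBasis (KSet n k) ℂ (FunSpace n k)) : Prop :=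
  ∀ x : KSet n k, ∃ C : ℕ → Submodule ℂ (FunSpace n k), ∃ w : Finset (Fin n),
    (∀ j ∈ Finset.Icc 1 i, C j ∈ isotypicSpaces n k j) ∧ b x ∈ gtSpace n k i C w

/-- A sequence of bases `B 0, …, B n` from the delta basis to a Gelfand–Tsetlin basis through
intermediate bases. (`S_1` is trivial, so the vectors of `B 1` are delta functions up to order and
scalars; they are taken to be the delta functions themselves.) -/
structure IsBasisChain (n k : ℕ)
    (B : ℕ → OrthonormalBasis (KSet n k) ℂ (FunSpace n k)) : Prop where
  zero : B 0 = deltaBasis n k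
  one : B 1 = B 0
  gt : ∀ i, 1 ≤ i → i ≤ n → IsGTBasis n k i (B i)

/-- The change of basis matrix `[b]_{b'}`: its columns are the coordinate vectors in `b'` of
the vectors of `b`. -/
noncomputable def changeMatrix {n k : ℕ} (b b' : OrthonormalBasis (KSet n k) ℂ (FunSpace n k)) :
    Matrix (KSet n k) (KSet n k) ℂ :=
  b'.toBasis.toMatrix b

/-- Straight-line computations on an input vector `a : ι → ℂ`. `Computation A m S` says that `S` is
the set of the quantities, as functions of the input, that are available after `m` operations.
At the start these are the entries of the input and `0`. One operation is one complex
multiplication and addition: it forms `c * u + v` from available `u`, `v` and a constant `c ∈ A`. -/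
inductive Computation {ι : Type} (A : Set ℂ) : ℕ → Set ((ι → ℂ) → ℂ) → Prop
  | start : Computation A 0 (insert (fun _ => 0) (Set.range fun (x : ι) (a : ι → ℂ) => a x))
  | mulAdd {m : ℕ} {S : Set ((ι → ℂ) → ℂ)} {c : ℂ} {u v : (ι → ℂ) → ℂ} :
      Computation A m S → c ∈ A → u ∈ S → v ∈ S →
        Computation A (m + 1) (insert (fun a => c * u a + v a) S)

end JohnsonFFT

/-! Isotypic components are traded for eigenvalues. The sum of the transpositions of S_j is central
in the group algebra of S_j, so by Schur's lemma it is a scalar on each isotypic component under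
S_j. Hence every `gtSpace` lies in a joint eigenspace `jointSpace` of commuting symmetric operators,
and the heart of the matter is that these joint eigenspaces have dimension at most one
(`finrank_jointSpace_le_one`).

This goes by induction, splitting words by the letter at the last place p on which the larger group
acts. If neither restriction were injective on a joint eigenspace, it would contain nonzero f and g
supported on words with and without the letter 1 at p. The Jucys–Murphy element, the sum of the
transpositions (a p) with a < p, has the same eigenvalue on both. On f this eigenvalue is the number
of letters 1 before p, on g the number of letters 2. Comparing the counts, the words of g have
letter 1 at more than half of the places before p. But g is killed by the lowering operator, which
is injective there (`eq_zero_of_sum_swap_eq_zero`).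

Simplicity of the spectrum also gives a converse: nonzero joint eigenvectors lie in some `gtSpace`
(`isGTBasis_iff`). So simultaneous diagonalization over the reals yields the bases. A vector of the
basis i + 1 that is not orthogonal to a given vector of the basis i shares its eigenvalues for S_1,
…, S_i and its letters after place i + 1. The space of such vectors embeds in a sum of two spaces of
dimension at most one (`finrank_jointSpace_succ_le_two`), whence two nonzero entries per column and
one operation per nonzero entry. -/

namespace JohnsonFFT

open Equiv

/-! ### Transposition sums and letter projections -/

/-- The first `j` places. -/
def low (n j : ℕ) : Finset (Fin n) := {m | (m : ℕ) < j}

theorem mem_low {n j : ℕ} {m : Fin n} : m ∈ low n j ↔ (m : ℕ) < j := by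
  simp [low]

instance {n k : ℕ} (m : Fin n) (x : KSet n k) : Decidable (m ∈ x) :=
  inferInstanceAs (Decidable (m ∈ (x : Finset (Fin n))))

theorem mem_swap_smul {n k : ℕ} (a b m : Fin n) (x : KSet n k) :
    m ∈ (swap a b • x) ↔ swap a b m ∈ x := by
  rw [← Set.powersetCard.mem_coe_iff, ← Set.powersetCard.mem_coe_iff, Set.powersetCard.coe_smul,
    ← Finset.inv_smul_mem_iff]
  simp

/-- The sum of the operators of all the transpositions `(a b)`, `a, b < j`, over ordered pairs and
including the trivial ones `a = b`. Up to scalars this is the class sum of the transpositions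
of `S_j`. -/
noncomputable def transpSum (𝕜 : Type*) [RCLike 𝕜] (n k j : ℕ) :
    EuclideanSpace 𝕜 (KSet n k) →ₗ[𝕜] EuclideanSpace 𝕜 (KSet n k) where
  toFun f := WithLp.toLp 2 fun x => ∑ a ∈ low n j, ∑ b ∈ low n j, f (swap a b • x)
  map_add' f g := by
    ext x
    simp [Finset.sum_add_distrib]
  map_smul' c f := by
    ext x
    simp [Finset.mul_sum]

/-- The operator that restricts a function to the words with the letter `1` at the place `m`. -/
noncomputable def letterProj (𝕜 : Type*) [RCLike 𝕜] (n k : ℕ) (m : Fin n) :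
    EuclideanSpace 𝕜 (KSet n k) →ₗ[𝕜] EuclideanSpace 𝕜 (KSet n k) where
  toFun f := WithLp.toLp 2 fun x => if m ∈ x then f x else 0
  map_add' f g := by
    ext x
    by_cases h : m ∈ x <;> simp [h]
  map_smul' c f := by
    ext x
    by_cases h : m ∈ x <;> simp [h]

section Operators

variable {𝕜 : Type*} [RCLike 𝕜] {n k : ℕ}

theorem transpSum_apply (j : ℕ) (f : EuclideanSpace 𝕜 (KSet n k)) (x : KSet n k) :
    transpSum 𝕜 n k j f x = ∑ a ∈ low n j, ∑ b ∈ low n j, f (swap a b • x) := rfl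

theorem letterProj_apply (m : Fin n) (f : EuclideanSpace 𝕜 (KSet n k)) (x : KSet n k) :
    letterProj 𝕜 n k m f x = if m ∈ x then f x else 0 := rfl

/-- Each transposition is an involution that permutes the orthonormal delta functions, so its
operator is self-adjoint. -/
theorem transpSum_isSymmetric (j : ℕ) : (transpSum 𝕜 n k j).IsSymmetric := by
  intro f g
  simp only [PiLp.inner_apply, transpSum_apply, sum_inner, inner_sum]
  rw [Finset.sum_comm]
  conv_rhs => rw [Finset.sum_comm]
  refine Finset.sum_congr rfl fun a _ => ?_
  rw [Finset.sum_comm]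
  conv_rhs => rw [Finset.sum_comm]
  refine Finset.sum_congr rfl fun b _ => ?_
  rw [← Equiv.sum_comp (MulAction.toPerm (swap a b))]
  refine Finset.sum_congr rfl fun x _ => ?_
  simp [← mul_smul]

theorem letterProj_isSymmetric (m : Fin n) : (letterProj 𝕜 n k m).IsSymmetric := by
  intro f g
  simp only [PiLp.inner_apply, letterProj_apply]
  refine Finset.sum_congr rfl fun x _ => ?_
  split_ifs <;> simp

/-- A permutation that maps the first `j` places to themselves commutes with the sum of the
transpositions. -/
theorem sum_swap_smul_comm {M : Type*} [AddCommMonoid M] {j : ℕ} {τ : Perm (Fin n)}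
    (hτ : ∀ m, τ m ∈ low n j ↔ m ∈ low n j) (f : KSet n k → M) (x : KSet n k) :
    ∑ a ∈ low n j, ∑ b ∈ low n j, f (swap a b • τ • x) =
      ∑ a ∈ low n j, ∑ b ∈ low n j, f (τ • swap a b • x) := by
  symm
  refine Finset.sum_equiv τ (fun a => (hτ a).symm) fun a _ => ?_
  refine Finset.sum_equiv τ (fun b => (hτ b).symm) fun b _ => ?_
  rw [← mul_smul, ← mul_smul, Equiv.mul_swap_eq_swap_mul]

theorem swap_mem_low_iff {i j : ℕ} (hij : i ≤ j) {a b : Fin n} (ha : a ∈ low n i)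
    (hb : b ∈ low n i) (m : Fin n) : swap a b m ∈ low n j ↔ m ∈ low n j := by
  rw [mem_low] at ha hb
  rw [mem_low, mem_low, swap_apply_def]
  split_ifs with h1 h2
  · subst h1; omega
  · subst h2; omega
  · rfl

/-- Conjugation by an element of S_i, contained in S_j, permutes the transpositions of S_j. -/
theorem transpSum_commute_of_le {i j : ℕ} (hij : i ≤ j) :
    Commute (transpSum 𝕜 n k i) (transpSum 𝕜 n k j) := by
  refine LinearMap.ext fun f => ?_
  ext x
  simp only [Module.End.mul_apply, transpSum_apply]
  have h : ∀ a ∈ low n i, ∀ b ∈ low n i,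
      ∑ c ∈ low n j, ∑ d ∈ low n j, f (swap c d • swap a b • x) =
        ∑ c ∈ low n j, ∑ d ∈ low n j, f (swap a b • swap c d • x) :=
    fun a ha b hb => sum_swap_smul_comm (swap_mem_low_iff hij ha hb) f x
  rw [Finset.sum_congr rfl fun a ha => Finset.sum_congr rfl fun b hb => h a ha b hb]
  have e (l : ℕ) (F : Fin n → Fin n → 𝕜) : ∑ a ∈ low n l, ∑ b ∈ low n l, F a b =
      ∑ p ∈ low n l ×ˢ low n l, F p.1 p.2 := (Finset.sum_product' ..).symm
  simp only [e]
  rw [Finset.sum_comm]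

theorem transpSum_commute (i j : ℕ) : Commute (transpSum 𝕜 n k i) (transpSum 𝕜 n k j) :=
  (le_total i j).elim transpSum_commute_of_le fun h => (transpSum_commute_of_le h).symm

theorem mem_swap_smul_of_le {j : ℕ} {m : Fin n} (hm : j ≤ m) {a b : Fin n} (ha : a ∈ low n j)
    (hb : b ∈ low n j) (x : KSet n k) : m ∈ swap a b • x ↔ m ∈ x := by
  rw [mem_low] at ha hb
  rw [mem_swap_smul, swap_apply_of_ne_of_ne] <;> rintro rfl <;> omega

theorem transpSum_commute_letterProj {j : ℕ} {m : Fin n} (hm : j ≤ m) :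
    Commute (transpSum 𝕜 n k j) (letterProj 𝕜 n k m) := by
  refine LinearMap.ext fun f => ?_
  ext x
  simp only [Module.End.mul_apply, transpSum_apply, letterProj_apply]
  rw [Finset.sum_congr rfl fun a ha => Finset.sum_congr rfl fun b hb => by
    rw [if_congr (mem_swap_smul_of_le hm ha hb x) rfl rfl]]
  split_ifs <;> simp

theorem letterProj_commute (m m' : Fin n) :
    Commute (letterProj 𝕜 n k m) (letterProj 𝕜 n k m') := by
  refine LinearMap.ext fun f => ?_
  ext x
  simp only [Module.End.mul_apply, letterProj_apply]
  split_ifs <;> rfl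

end Operators

/-! ### Words with a fixed ending and joint eigenspaces -/

theorem mem_suffixSpace {n k i : ℕ} {w : Finset (Fin n)} {f : FunSpace n k} :
    f ∈ suffixSpace n k i w ↔ ∀ x, f x ≠ 0 → ∀ m : Fin n, i ≤ (m : ℕ) → (m ∈ x ↔ m ∈ w) := by
  constructor
  · intro hf x hx
    by_contra hxw
    refine hx ?_
    rw [suffixSpace] at hf
    induction hf using Submodule.span_induction with
    | mem f hf =>
      obtain ⟨y, hy, rfl⟩ := hf
      rw [deltaBasis, EuclideanSpace.basisFun_apply, PiLp.single_apply, if_neg]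
      rintro rfl
      exact hxw hy
    | zero => rfl
    | add f g _ _ hf hg =>
      by_contra h
      rw [PiLp.add_apply] at h
      by_cases h1 : f x = 0
      · by_cases h2 : g x = 0
        · simp [h1, h2] at h
        · exact h2 (hg h2)
      · exact h1 (hf h1)
    | smul c f _ hf =>
      by_cases h1 : f x = 0
      · simp [h1]
      · exact absurd (hf h1) h1
  · intro h
    rw [← (deltaBasis n k).sum_repr f]
    refine Submodule.sum_mem _ fun x _ => ?_
    by_cases hx : f x = 0
    · simp [deltaBasis, hx]
    · exact Submodule.smul_mem _ _ (Submodule.subset_span ⟨x, h x hx, rfl⟩)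

/-- The joint eigenspace of the sums of the transpositions of `S_1, …, S_j` in the
space of the words that end like `w` after place `i`. -/
noncomputable def jointSpace (n k i j : ℕ) (c : ℕ → ℂ) (w : Finset (Fin n)) :
    Submodule ℂ (FunSpace n k) :=
  (⨅ l ∈ Finset.Icc 1 j, Module.End.eigenspace (transpSum ℂ n k l) (c l)) ⊓ suffixSpace n k i w

theorem mem_jointSpace {n k i j : ℕ} {c : ℕ → ℂ} {w : Finset (Fin n)} {f : FunSpace n k} :
    f ∈ jointSpace n k i j c w ↔
      (∀ l, 1 ≤ l → l ≤ j → transpSum ℂ n k l f = c l • f) ∧ f ∈ suffixSpace n k i w := by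
  simp [jointSpace, Submodule.mem_iInf]

/-! ### Simplicity of the joint spectrum -/

section Dimension

variable {n k : ℕ}

theorem card_low (p : Fin n) : (low n p).card = p := by
  have : low n p = Finset.Iio p := by
    ext m
    simp [mem_low]
  rw [this, Fin.card_Iio]

theorem low_succ (p : Fin n) : low n (p + 1) = insert p (low n p) := by
  ext m
  rw [Finset.mem_insert, mem_low, mem_low, Fin.ext_iff]
  omega

theorem self_notMem_low (p : Fin n) : p ∉ low n p := by
  simp [mem_low]

theorem swap_smul_eq_self {a b : Fin n} {x : KSet n k} (h : a ∈ x ↔ b ∈ x) :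
    swap a b • x = x := by
  refine SetLike.ext fun m => ?_
  rw [mem_swap_smul, swap_apply_def]
  split_ifs with h1 h2
  · rw [h1, h]
  · rw [h2, h]
  · rfl

/-- Ordered pairs count each new transposition (a p) twice; the last summand comes from the trivial
pair (p, p). -/
theorem transpSum_succ_apply {𝕜 : Type*} [RCLike 𝕜] (p : Fin n)
    (f : EuclideanSpace 𝕜 (KSet n k)) (x : KSet n k) :
    transpSum 𝕜 n k (p + 1) f x =
      transpSum 𝕜 n k p f x + 2 * ∑ a ∈ low n p, f (swap a p • x) + f x := by
  rw [transpSum_apply, transpSum_apply, low_succ, Finset.sum_insert (self_notMem_low p)]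
  simp only [Finset.sum_insert (self_notMem_low p), Finset.sum_add_distrib, swap_self]
  rw [Finset.sum_congr rfl fun a _ => by rw [swap_comm]]
  change f ((1 : Perm (Fin n)) • x) + _ + _ = _
  rw [one_smul]
  ring

/-- A joint eigenvector for `S_p` and `S_{p+1}` is an eigenvector of the Jucys–Murphy element. -/
theorem sum_swap_eq_of_eigenvector {p : Fin n} {f : FunSpace n k} {c d : ℂ}
    (hc : transpSum ℂ n k p f = c • f) (hd : transpSum ℂ n k (p + 1) f = d • f) (x : KSet n k) :
    ∑ a ∈ low n p, f (swap a p • x) = (d - c - 1) / 2 * f x := by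
  have h := transpSum_succ_apply p f x
  rw [hc, hd] at h
  simp only [PiLp.smul_apply, smul_eq_mul] at h
  linear_combination -h / 2

theorem card_filter_low_add_card_filter_compl (j : ℕ) (x : KSet n k) :
    ((low n j).filter (· ∈ x)).card + ((low n j)ᶜ.filter (· ∈ x)).card = k := by
  rw [← Finset.card_union_of_disjoint
    (Finset.disjoint_filter_filter disjoint_compl_right), ← Finset.filter_union,
    Finset.union_compl]
  conv_rhs => rw [← Set.powersetCard.card_eq x]
  congr 1
  ext m
  simp only [Finset.mem_filter, Finset.mem_univ, true_and]
  rfl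

/-- All words have exactly k letters 1, so those after the first j places determine how many are
left for the first j. -/
theorem card_filter_low_eq {j : ℕ} {x y : KSet n k}
    (h : ∀ m : Fin n, j ≤ (m : ℕ) → (m ∈ x ↔ m ∈ y)) :
    ((low n j).filter (· ∈ x)).card = ((low n j).filter (· ∈ y)).card := by
  have hx := card_filter_low_add_card_filter_compl j x
  have hy := card_filter_low_add_card_filter_compl j y
  have : (low n j)ᶜ.filter (· ∈ x) = (low n j)ᶜ.filter (· ∈ y) :=
    Finset.filter_congr fun m hm => h m (by simpa [mem_low] using hm)
  rw [this] at hx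
  omega

theorem card_filter_low_add_one {p : Fin n} {x y : KSet n k}
    (h : ∀ m : Fin n, p + 1 ≤ (m : ℕ) → (m ∈ x ↔ m ∈ y)) (hx : p ∈ x) (hy : p ∉ y) :
    ((low n p).filter (· ∈ x)).card + 1 = ((low n p).filter (· ∈ y)).card := by
  have := card_filter_low_eq h
  rw [low_succ, Finset.filter_insert, Finset.filter_insert, if_pos hx, if_neg hy,
    Finset.card_insert_of_notMem fun h => self_notMem_low p (Finset.mem_filter.1 h).1] at this
  exact this

/-- The number of common elements of `x` and `y` among the first `j` places. -/
def overlap (j : ℕ) (y x : KSet n k) : ℕ := ((low n j).filter fun a => a ∈ x ∧ a ∈ y).card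

theorem overlap_swap_smul_of_mem {p : Fin n} {x y : KSet n k} (hx : p ∉ x) {a : Fin n}
    (ha : a ∈ low n p) (hax : a ∈ x) (hay : a ∈ y) :
    overlap p y (swap a p • x) + 1 = overlap p y x := by
  have : (low n p).filter (fun b => b ∈ x ∧ b ∈ y) =
      insert a ((low n p).filter fun b => b ∈ swap a p • x ∧ b ∈ y) := by
    ext b
    rw [Finset.mem_insert, Finset.mem_filter, Finset.mem_filter, mem_swap_smul]
    by_cases hba : b = a
    · subst hba; simp [*]
    · by_cases hbp : b = p
      · subst hbp; simp [self_notMem_low, hba]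
      · rw [swap_apply_of_ne_of_ne hba hbp]; simp [hba]
  rw [overlap, overlap, this, Finset.card_insert_of_notMem]
  simp [mem_swap_smul, hx]

theorem overlap_swap_smul_of_notMem {p : Fin n} {x y : KSet n k} {a : Fin n} (hay : a ∉ y) :
    overlap p y (swap a p • x) = overlap p y x := by
  rw [overlap, overlap]
  congr 1
  refine Finset.filter_congr fun b hb => ?_
  rw [mem_swap_smul]
  by_cases hba : b = a
  · subst hba; simp [hay]
  · rw [swap_apply_of_ne_of_ne hba]
    rintro rfl
    exact self_notMem_low _ hb

/-- For a in x, the swap moves the element a to p, where `overlap p` does not see it. The overlap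
drops by one if a lies in y and stays the same otherwise, so a is chosen from the common elements in
the first case and from the rest of x in the second. -/
theorem card_filter_overlap_swap {p : Fin n} {x y : KSet n k} (hx : p ∉ x) (t : ℕ) :
    (((low n p).filter fun a => a ∈ x ∧ overlap p y (swap a p • x) = t).card : ℂ) =
      (if overlap p y x = t + 1 then (t + 1 : ℂ) else 0) +
        if overlap p y x = t then (((low n p).filter (· ∈ x)).card - t : ℂ) else 0 := by
  have hsplit : ((low n p).filter (· ∈ x)).card =
      overlap p y x + ((low n p).filter fun a => a ∈ x ∧ a ∉ y).card := by
    rw [overlap, ← Finset.filter_filter, ← Finset.filter_filter,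
      Finset.card_filter_add_card_filter_not]
  by_cases h1 : overlap p y x = t + 1
  · have : (low n p).filter (fun a => a ∈ x ∧ overlap p y (swap a p • x) = t) =
        (low n p).filter fun a => a ∈ x ∧ a ∈ y := by
      refine Finset.filter_congr fun a ha => and_congr_right fun hax => ?_
      by_cases hay : a ∈ y
      · have := overlap_swap_smul_of_mem hx ha hax hay
        simp only [hay, iff_true]
        omega
      · have := overlap_swap_smul_of_notMem (p := p) (x := x) hay
        simp only [hay, iff_false]
        omega
    rw [this, if_pos h1, if_neg (by omega)]
    change ((overlap p y x : ℕ) : ℂ) = _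
    rw [h1]
    push_cast
    ring
  · rw [if_neg h1, zero_add]
    by_cases h2 : overlap p y x = t
    · have : (low n p).filter (fun a => a ∈ x ∧ overlap p y (swap a p • x) = t) =
          (low n p).filter fun a => a ∈ x ∧ a ∉ y := by
        refine Finset.filter_congr fun a ha => and_congr_right fun hax => ?_
        by_cases hay : a ∈ y
        · have := overlap_swap_smul_of_mem hx ha hax hay
          simp only [hay, not_true, iff_false]
          omega
        · have := overlap_swap_smul_of_notMem (p := p) (x := x) hay
          simp only [hay, not_false_iff, iff_true]
          omega
      rw [this, if_pos h2, hsplit, h2]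
      push_cast
      ring
    · rw [if_neg h2, Nat.cast_eq_zero, Finset.card_eq_zero, Finset.filter_eq_empty_iff]
      rintro a ha ⟨hax, h⟩
      by_cases hay : a ∈ y
      · have := overlap_swap_smul_of_mem hx ha hax hay
        omega
      · have := overlap_swap_smul_of_notMem (p := p) (x := x) hay
        omega

/-- The lowering operator is injective above the middle layer. -/
theorem eq_zero_of_sum_swap_eq_zero {p : Fin n} {g : FunSpace n k} {y : KSet n k}
    (hp : ∀ x, g x ≠ 0 → p ∉ x)
    (hy : ∀ x, g x ≠ 0 → ∀ m : Fin n, (p : ℕ) ≤ m → (m ∈ x ↔ m ∈ y))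
    (hcard : (p : ℕ) < 2 * ((low n p).filter (· ∈ y)).card)
    (hg : ∀ z, p ∈ z → ∑ a ∈ low n p, g (swap a p • z) = 0) : g y = 0 := by
  set l := ((low n p).filter (· ∈ y)).card with hl
  have hlx (x : KSet n k) (hx : g x ≠ 0) : ((low n p).filter (· ∈ x)).card = l :=
    card_filter_low_eq (hy x hx)
  -- The function g is summed over the words at fixed overlap with y. The vanishing of the lowering
  -- operator becomes a two-term recursion in t, which carries h 0 = 0 up to h l = g y.
  let h (t : ℕ) : ℂ := ∑ x : KSet n k, if overlap p y x = t then g x else 0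
  -- Sum `hg` over all z that contain p and have overlap t with y, then substitute x = swap a p • z
  -- and count the a for each x.
  have hrec (t : ℕ) : (t + 1 : ℂ) * h (t + 1) + (l - t) * h t = 0 := by
    have h0 : ∑ z : KSet n k, (if p ∈ z ∧ overlap p y z = t then
        ∑ a ∈ low n p, g (swap a p • z) else 0) = 0 := by
      refine Finset.sum_eq_zero fun z _ => ?_
      split_ifs with hz
      · exact hg z hz.1
      · rfl
    have h1 : ∑ z : KSet n k, (if p ∈ z ∧ overlap p y z = t then
        ∑ a ∈ low n p, g (swap a p • z) else 0) = ∑ x : KSet n k, ∑ a ∈ low n p,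
          if a ∈ x ∧ overlap p y (swap a p • x) = t then g x else 0 := by
      conv_rhs => rw [Finset.sum_comm]
      rw [Finset.sum_congr rfl fun z _ => show (if p ∈ z ∧ overlap p y z = t then
        ∑ a ∈ low n p, g (swap a p • z) else 0) = ∑ a ∈ low n p,
          if p ∈ z ∧ overlap p y z = t then g (swap a p • z) else 0 by split_ifs <;> simp]
      rw [Finset.sum_comm]
      refine Finset.sum_congr rfl fun a _ => ?_
      rw [← Equiv.sum_comp (MulAction.toPerm (swap a p))]
      refine Finset.sum_congr rfl fun x _ => ?_
      simp [mem_swap_smul, ← mul_smul]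
    rw [h0] at h1
    rw [h1, Finset.mul_sum, Finset.mul_sum, ← Finset.sum_add_distrib]
    refine Finset.sum_congr rfl fun x _ => ?_
    by_cases hx : g x = 0
    · simp [hx]
    rw [← Finset.sum_filter, Finset.sum_const, nsmul_eq_mul,
      card_filter_overlap_swap (hp x hx), hlx x hx]
    split_ifs <;> ring
  have hzero (t : ℕ) : h t = 0 := by
    induction t with
    -- Two l-subsets of the p places before p meet, as p < 2 * l; so no word in the support has
    -- overlap 0.
    | zero =>
      refine Finset.sum_eq_zero fun x _ => ?_
      split_ifs with hx
      · by_contra hgx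
        have h1 := hlx x hgx
        have hd : Disjoint ((low n p).filter (· ∈ x)) ((low n p).filter (· ∈ y)) := by
          rw [overlap, Finset.card_eq_zero, Finset.filter_eq_empty_iff] at hx
          rw [Finset.disjoint_filter]
          exact fun a ha hax hay => hx ha ⟨hax, hay⟩
        have h2 := Finset.card_le_card (Finset.union_subset
          (Finset.filter_subset (· ∈ x) (low n p)) (Finset.filter_subset (· ∈ y) (low n p)))
        rw [Finset.card_union_of_disjoint hd, h1, card_low] at h2
        omega
      · rfl
    | succ t ih =>
      have := hrec t
      rw [ih, mul_zero, add_zero] at this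
      exact (mul_eq_zero.1 this).resolve_left (by exact_mod_cast t.succ_ne_zero)
  -- A word in the support with overlap l contains all elements of y before p and agrees with y from
  -- p on; having the same size, it equals y.
  have hlast : h l = g y := by
    change ∑ x : KSet n k, _ = _
    rw [Finset.sum_eq_single y]
    · simp [overlap, hl]
    · intro x _ hxy
      split_ifs with hx
      · by_contra hgx
        refine hxy (Set.powersetCard.eq_iff_subset.2 fun m hm => ?_).symm
        change m ∈ y at hm
        change m ∈ x
        by_cases hmp : (p : ℕ) ≤ m
        · exact (hy x hgx m hmp).2 hm
        · have hsub : (low n p).filter (fun a => a ∈ x ∧ a ∈ y) ⊆ (low n p).filter (· ∈ y) :=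
            Finset.monotone_filter_right _ fun a _ ha => ha.2
          have heq := Finset.eq_of_subset_of_card_le hsub hx.ge
          have : m ∈ (low n p).filter (fun a => a ∈ x ∧ a ∈ y) := by
            rw [heq]
            exact Finset.mem_filter.2 ⟨mem_low.2 (by omega), hm⟩
          exact (Finset.mem_filter.1 this).2.1
      · rfl
    · exact fun hy => absurd (Finset.mem_univ y) hy
  rw [← hlast, hzero]

/-- Two nonzero joint eigenvectors for `S_p` and `S_{p+1}` with the same eigenvalues and the same
letters after place `p` cannot have constant and opposite letters at place `p`. -/
theorem eq_zero_or_eq_zero_of_opposite_letters {p : Fin n} {f g : FunSpace n k} {c d : ℂ}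
    {w : Finset (Fin n)}
    (hf : f ∈ suffixSpace n k (p + 1) w) (hg : g ∈ suffixSpace n k (p + 1) w)
    (hfc : transpSum ℂ n k p f = c • f) (hfd : transpSum ℂ n k (p + 1) f = d • f)
    (hgc : transpSum ℂ n k p g = c • g) (hgd : transpSum ℂ n k (p + 1) g = d • g)
    (hfp : ∀ x, f x ≠ 0 → p ∈ x) (hgp : ∀ x, g x ≠ 0 → p ∉ x) : f = 0 ∨ g = 0 := by
  by_contra! hne
  obtain ⟨x, hx⟩ : ∃ x, f x ≠ 0 := by
    by_contra! h
    exact hne.1 (by ext x; exact h x)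
  obtain ⟨y, hy⟩ : ∃ y, g y ≠ 0 := by
    by_contra! h
    exact hne.2 (by ext x; exact h x)
  rw [mem_suffixSpace] at hf hg
  have hf' := sum_swap_eq_of_eigenvector hfc hfd
  have hg' := sum_swap_eq_of_eigenvector hgc hgd
  set μ := (d - c - 1) / 2
  -- Evaluate the Jucys–Murphy element at x: for a in x the swap fixes x, and for a not in x it
  -- removes p from x, where f vanishes.
  have h1 : (((low n p).filter (· ∈ x)).card : ℂ) = μ := by
    have := hf' x
    rw [Finset.sum_congr rfl (g := fun a => if a ∈ x then f x else 0), ← Finset.sum_filter,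
      Finset.sum_const, nsmul_eq_mul] at this
    · exact mul_right_cancel₀ hx this
    · intro a _
      split_ifs with ha
      · rw [swap_smul_eq_self (by simp [ha, hfp x hx])]
      · by_contra h
        have := hfp _ h
        rw [mem_swap_smul, swap_apply_right] at this
        exact ha this
  -- Symmetrically, the swap fixes y when a is not in y, and otherwise brings p into y, where g
  -- vanishes.
  have h2 : (((low n p).filter (· ∉ y)).card : ℂ) = μ := by
    have := hg' y
    rw [Finset.sum_congr rfl (g := fun a => if a ∉ y then g y else 0), ← Finset.sum_filter,
      Finset.sum_const, nsmul_eq_mul] at this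
    · exact mul_right_cancel₀ hy this
    · intro a _
      by_cases ha : a ∈ y
      · rw [if_neg (not_not.2 ha)]
        by_contra h
        have := hgp _ h
        rw [mem_swap_smul, swap_apply_right] at this
        exact this ha
      · rw [if_pos ha, swap_smul_eq_self (by simp [ha, hgp y hy])]
  have h3 : ((low n p).filter (· ∈ x)).card = ((low n p).filter (· ∉ y)).card := by
    exact_mod_cast h1.trans h2.symm
  have h4 := card_filter_low_add_one
    (fun m hm => (hf x hx m hm).trans (hg y hy m hm).symm) (hfp x hx) (hgp y hy)
  have h5 := Finset.card_filter_add_card_filter_not (s := low n p) (· ∈ y)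
  rw [card_low] at h5
  -- With l letters 1 of y before p, the counts give p - l = l - 1, so p < 2 * l.
  refine hy (eq_zero_of_sum_swap_eq_zero hgp (fun z hz m hm => ?_) (by omega) fun z hz => ?_)
  · rcases hm.eq_or_lt with h | h
    · have : p = m := Fin.ext h
      subst this
      simp [hgp z hz, hgp y hy]
    · exact (hg z hz m h).trans (hg y hy m h).symm
  · rw [hg' z, mul_eq_zero]
    right
    by_contra h
    exact hgp z h hz

theorem letterProj_mem_jointSpace {p : Fin n} {j : ℕ} (hj : j ≤ p) {c : ℕ → ℂ}
    {w : Finset (Fin n)} {f : FunSpace n k} (hf : f ∈ jointSpace n k (p + 1) j c w) :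
    letterProj ℂ n k p f ∈ jointSpace n k p j c (insert p w) := by
  rw [mem_jointSpace] at hf ⊢
  refine ⟨fun l hl hlj => ?_, mem_suffixSpace.2 fun x hx m hm => ?_⟩
  · have := LinearMap.congr_fun
      (transpSum_commute_letterProj (𝕜 := ℂ) (k := k) (hlj.trans hj) : Commute _ _).eq f
    rw [Module.End.mul_apply, Module.End.mul_apply, hf.1 l hl hlj, map_smul] at this
    exact this
  · rw [letterProj_apply] at hx
    have hpx : p ∈ x := by
      by_contra h
      simp [h] at hx
    rw [if_pos hpx] at hx
    rw [Finset.mem_insert]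
    rcases hm.eq_or_lt with h | h
    · have : p = m := Fin.ext h
      subst this
      simp [hpx]
    · rw [mem_suffixSpace.1 hf.2 x hx m h, or_iff_right]
      rintro rfl
      exact absurd h (lt_irrefl _)

theorem sub_letterProj_apply (p : Fin n) (f : FunSpace n k) (x : KSet n k) :
    (f - letterProj ℂ n k p f) x = if p ∈ x then 0 else f x := by
  rw [PiLp.sub_apply, letterProj_apply]
  split_ifs <;> simp

theorem sub_letterProj_mem_jointSpace {p : Fin n} {j : ℕ} (hj : j ≤ p) {c : ℕ → ℂ}
    {w : Finset (Fin n)} {f : FunSpace n k} (hf : f ∈ jointSpace n k (p + 1) j c w) :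
    f - letterProj ℂ n k p f ∈ jointSpace n k p j c (w.erase p) := by
  have hf' := mem_jointSpace.1 (letterProj_mem_jointSpace hj hf)
  rw [mem_jointSpace] at hf ⊢
  refine ⟨fun l hl hlj => ?_, mem_suffixSpace.2 fun x hx m hm => ?_⟩
  · rw [map_sub, hf.1 l hl hlj, hf'.1 l hl hlj, smul_sub]
  · rw [sub_letterProj_apply] at hx
    have hpx : p ∉ x := by
      intro h
      simp [h] at hx
    rw [if_neg hpx] at hx
    rw [Finset.mem_erase]
    rcases hm.eq_or_lt with h | h
    · have : p = m := Fin.ext h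
      subst this
      simp [hpx]
    · rw [mem_suffixSpace.1 hf.2 x hx m h, and_iff_right]
      rintro rfl
      exact absurd h (lt_irrefl _)

theorem jointSpace_mono {i j l : ℕ} (h : l ≤ j) (c : ℕ → ℂ) (w : Finset (Fin n)) :
    jointSpace n k i j c w ≤ jointSpace n k i l c w := fun _ hf =>
  mem_jointSpace.2 ⟨fun m hm hml => (mem_jointSpace.1 hf).1 m hm (hml.trans h),
    (mem_jointSpace.1 hf).2⟩

/-- Restriction to the words with the letter `1` at place `p`. -/
noncomputable def restrictMem (p : Fin n) {j : ℕ} (hj : j ≤ p) (c : ℕ → ℂ) (w : Finset (Fin n)) :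
    jointSpace n k (p + 1) j c w →ₗ[ℂ] jointSpace n k p j c (insert p w) :=
  (letterProj ℂ n k p).restrict fun _ hf => letterProj_mem_jointSpace hj hf

/-- Restriction to the words without the letter `1` at place `p`. -/
noncomputable def restrictNotMem (p : Fin n) {j : ℕ} (hj : j ≤ p) (c : ℕ → ℂ)
    (w : Finset (Fin n)) :
    jointSpace n k (p + 1) j c w →ₗ[ℂ] jointSpace n k p j c (w.erase p) :=
  (LinearMap.id - letterProj ℂ n k p).restrict fun _ hf => sub_letterProj_mem_jointSpace hj hf

theorem finrank_suffixSpace_zero_le_one (w : Finset (Fin n)) :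
    Module.finrank ℂ (suffixSpace n k 0 w) ≤ 1 := by
  by_cases hw : w.card = k
  · let y : KSet n k := ⟨w, hw⟩
    refine finrank_le_one ⟨deltaBasis n k y, Submodule.subset_span ⟨y, fun m _ => Iff.rfl, rfl⟩⟩ ?_
    rintro ⟨f, hf⟩
    refine ⟨f y, Subtype.ext ?_⟩
    ext x
    change f y * deltaBasis n k y x = f x
    rw [deltaBasis, EuclideanSpace.basisFun_apply, PiLp.single_apply]
    split_ifs with h
    · rw [h, mul_one]
    · rw [mul_zero]
      by_contra hx
      refine h (SetLike.ext fun m => ?_)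
      exact mem_suffixSpace.1 hf x (Ne.symm hx) m (Nat.zero_le _)
  · have : suffixSpace n k 0 w = ⊥ := by
      rw [eq_bot_iff]
      intro f hf
      rw [Submodule.mem_bot]
      ext x
      by_contra hx
      have : (x : Finset (Fin n)) = w :=
        Finset.ext fun m => mem_suffixSpace.1 hf x hx m (Nat.zero_le _)
      exact hw (this ▸ Set.powersetCard.card_eq x)
    rw [this]
    simp

/-- The joint spectrum of the sums of transpositions is simple. -/
theorem finrank_jointSpace_le_one {i : ℕ} (hi : i ≤ n) (c : ℕ → ℂ) (w : Finset (Fin n)) :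
    Module.finrank ℂ (jointSpace n k i i c w) ≤ 1 := by
  induction i generalizing w with
  | zero =>
    have : jointSpace n k 0 0 c w = suffixSpace n k 0 w := by simp [jointSpace]
    rw [this]
    exact finrank_suffixSpace_zero_le_one w
  | succ i ih =>
    obtain ⟨p, rfl⟩ : ∃ p : Fin n, (p : ℕ) = i := ⟨⟨i, hi⟩, rfl⟩
    let ι := Submodule.inclusion
      (jointSpace_mono (n := n) (k := k) (i := p + 1) (Nat.le_succ p) c w)
    have hι : Function.Injective ι := Submodule.inclusion_injective _
    let r₁ := restrictMem (k := k) p le_rfl c w ∘ₗ ι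
    let r₀ := restrictNotMem (k := k) p le_rfl c w ∘ₗ ι
    suffices h : Function.Injective r₁ ∨ Function.Injective r₀ by
      rcases h with h | h
      · exact (LinearMap.finrank_le_finrank_of_injective h).trans (ih (by omega) _)
      · exact (LinearMap.finrank_le_finrank_of_injective h).trans (ih (by omega) _)
    by_contra! h
    simp only [injective_iff_map_eq_zero, not_forall] at h
    obtain ⟨⟨⟨g, hg⟩, hg0, hg1⟩, ⟨⟨f, hf⟩, hf0, hf1⟩⟩ := h
    have hgz : letterProj ℂ n k p g = 0 := congrArg Subtype.val hg0
    have hfz : f - letterProj ℂ n k p f = 0 := congrArg Subtype.val hf0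
    have hf' := mem_jointSpace.1 hf
    have hg' := mem_jointSpace.1 hg
    -- The value `c 0` is unconstrained; for p = 0 the transposition sum is empty and its eigenvalue
    -- is 0.
    have hlow (u : FunSpace n k) (hu : ∀ l, 1 ≤ l → l ≤ (p : ℕ) + 1 →
        transpSum ℂ n k l u = c l • u) :
        transpSum ℂ n k p u = (if (p : ℕ) = 0 then 0 else c p) • u := by
      split_ifs with hp
      · ext x
        have : low n (p : ℕ) = ∅ := by
          rw [← Finset.card_eq_zero, card_low, hp]
        rw [transpSum_apply, this]
        simp
      · exact hu p (by omega) (by omega)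
    have hfp (x : KSet n k) (hx : f x ≠ 0) : p ∈ x := by
      by_contra hpx
      have := sub_letterProj_apply p f x
      rw [hfz, if_neg hpx] at this
      exact hx this.symm
    have hgp (x : KSet n k) (hx : g x ≠ 0) : p ∉ x := by
      intro hpx
      have := letterProj_apply p g x
      rw [hgz, if_pos hpx] at this
      exact hx this.symm
    rcases eq_zero_or_eq_zero_of_opposite_letters hf'.2 hg'.2 (hlow f hf'.1)
      (hf'.1 _ (by omega) le_rfl) (hlow g hg'.1) (hg'.1 _ (by omega) le_rfl) hfp hgp with h | h
    · exact hf1 (Subtype.ext h)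
    · exact hg1 (Subtype.ext h)

/-- A function is determined by its restrictions to the words with and without the letter 1 at place
i, and each restriction lies in a space of dimension at most one. -/
theorem finrank_jointSpace_succ_le_two {i : ℕ} (hi : i < n) (c : ℕ → ℂ) (w : Finset (Fin n)) :
    Module.finrank ℂ (jointSpace n k (i + 1) i c w) ≤ 2 := by
  obtain ⟨p, rfl⟩ : ∃ p : Fin n, (p : ℕ) = i := ⟨⟨i, hi⟩, rfl⟩
  have hinj : Function.Injective
      ((restrictMem (k := k) p le_rfl c w).prod (restrictNotMem p le_rfl c w)) := by
    rw [injective_iff_map_eq_zero]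
    rintro ⟨f, hf⟩ h
    rw [LinearMap.prod_apply] at h
    have h1 : letterProj ℂ n k p f = 0 := congrArg Subtype.val (congrArg Prod.fst h)
    have h2 : f - letterProj ℂ n k p f = 0 := congrArg Subtype.val (congrArg Prod.snd h)
    rw [h1, sub_zero] at h2
    exact Subtype.ext h2
  refine (LinearMap.finrank_le_finrank_of_injective hinj).trans ?_
  rw [Module.finrank_prod]
  have h1 := finrank_jointSpace_le_one (k := k) p.2.le c (insert p w)
  have h2 := finrank_jointSpace_le_one (k := k) p.2.le c (w.erase p)
  omega

end Dimension

/-! ### Isotypic components and joint eigenspaces -/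

section Isotypic

variable {n k : ℕ}

theorem mem_symSub {j : ℕ} {σ : Perm (Fin n)} :
    σ ∈ symSub n j ↔ ∀ m : Fin n, j ≤ (m : ℕ) → σ m = m := by
  simp [symSub, mem_fixingSubgroup_iff]

theorem symSub_mono {i j : ℕ} (h : i ≤ j) : symSub n i ≤ symSub n j := fun _ hσ =>
  mem_symSub.2 fun m hm => mem_symSub.1 hσ m (h.trans hm)

theorem apply_mem_low_iff {j : ℕ} {σ : Perm (Fin n)} (hσ : σ ∈ symSub n j) (m : Fin n) :
    σ m ∈ low n j ↔ m ∈ low n j := by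
  rw [mem_symSub] at hσ
  rw [mem_low, mem_low, ← not_le, ← not_le, not_iff_not]
  refine ⟨fun h => ?_, fun h => by rwa [hσ m h]⟩
  have := σ.injective (hσ _ h)
  rwa [this] at h

theorem swap_mem_symSub {j : ℕ} {a b : Fin n} (ha : a ∈ low n j) (hb : b ∈ low n j) :
    swap a b ∈ symSub n j := by
  rw [mem_low] at ha hb
  refine mem_symSub.2 fun m hm => swap_apply_of_ne_of_ne ?_ ?_ <;> rintro rfl <;> omega

theorem permRep_apply (σ : Perm (Fin n)) (f : FunSpace n k) (x : KSet n k) :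
    permRep n k σ f x = f (σ⁻¹ • x) := rfl

theorem transpSum_permRep {j : ℕ} {σ : Perm (Fin n)} (hσ : σ ∈ symSub n j) (f : FunSpace n k) :
    transpSum ℂ n k j (permRep n k σ f) = permRep n k σ (transpSum ℂ n k j f) := by
  ext x
  simp only [transpSum_apply, permRep_apply]
  exact (sum_swap_smul_comm (apply_mem_low_iff (inv_mem hσ)) f x).symm

/-- The sum of the transpositions of `S_j` in the group algebra. -/
noncomputable def transpElt (n j : ℕ) : MonoidAlgebra ℂ (symSub n j) :=
  ∑ a : low n j, ∑ b : low n j,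
    MonoidAlgebra.of ℂ (symSub n j) ⟨swap a b, swap_mem_symSub a.2 b.2⟩

theorem asAlgebraHom_transpElt (j : ℕ) :
    (subRep n k j).asAlgebraHom (transpElt n j) = transpSum ℂ n k j := by
  refine LinearMap.ext fun f => ?_
  ext x
  simp only [transpElt, map_sum, Representation.asAlgebraHom_of, LinearMap.sum_apply,
    transpSum_apply, WithLp.ofLp_sum, Finset.sum_apply]
  rw [← Finset.sum_coe_sort (low n j)]
  refine Finset.sum_congr rfl fun a _ => ?_
  rw [← Finset.sum_coe_sort (low n j)]
  refine Finset.sum_congr rfl fun b _ => ?_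
  change permRep n k (swap a b) f x = _
  rw [permRep_apply, swap_inv]

/-- The sum of the transpositions of `S_j` as an endomorphism over the group algebra. -/
noncomputable def transpEnd (n k j : ℕ) :
    Module.End (MonoidAlgebra ℂ (symSub n j)) (subRep n k j).asModule :=
  MonoidAlgebra.equivariantOfLinearOfComm
    ((subRep n k j).asModuleEquiv.symm.toLinearMap ∘ₗ transpSum ℂ n k j ∘ₗ
      (subRep n k j).asModuleEquiv.toLinearMap) fun g v => by
    rw [Representation.single_smul, Representation.single_smul, one_smul, one_smul]
    exact transpSum_permRep g.2 v

/-- As multiplication by an algebra element, the endomorphism preserves every submodule and is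
carried along by module isomorphisms. -/
theorem transpEnd_eq_smul (j : ℕ) (v : (subRep n k j).asModule) :
    transpEnd n k j v = transpElt n j • v := by
  change transpSum ℂ n k j v = (subRep n k j).asAlgebraHom (transpElt n j) v
  rw [asAlgebraHom_transpElt]

/-- The sum of the transpositions of `S_j` is a scalar on each isotypic component. -/
theorem exists_eigenvalue_of_mem_isotypicSpaces {j : ℕ} {C : Submodule ℂ (FunSpace n k)}
    (hC : C ∈ isotypicSpaces n k j) : ∃ c : ℂ, ∀ f ∈ C, transpSum ℂ n k j f = c • f := by
  obtain ⟨D, ⟨S, hS, rfl⟩, rfl⟩ := hC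
  have hSt (s : (subRep n k j).asModule) (hs : s ∈ S) : transpEnd n k j s ∈ S := by
    rw [transpEnd_eq_smul]
    exact S.smul_mem _ hs
  have : FiniteDimensional ℂ S :=
    inferInstanceAs (FiniteDimensional ℂ (S.restrictScalars ℂ))
  -- Schur's lemma over an algebraically closed field.
  obtain ⟨c, hc⟩ := (IsSimpleModule.algebraMap_end_bijective_of_isAlgClosed
    (A := MonoidAlgebra ℂ (symSub n j)) (V := S) ℂ).2 ((transpEnd n k j).restrict hSt)
  have hcS (s : S) : transpElt n j • s = c • s := by
    have := LinearMap.congr_fun hc s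
    rw [Module.algebraMap_end_apply] at this
    rw [this]
    exact Subtype.ext (transpEnd_eq_smul j (s : (subRep n k j).asModule)).symm
  have hle : isotypicComponent (MonoidAlgebra ℂ (symSub n j)) (subRep n k j).asModule S ≤
      LinearMap.ker (transpEnd n k j - algebraMap ℂ _ c) := by
    refine sSup_le ?_
    rintro N ⟨e⟩ v hv
    rw [LinearMap.mem_ker, LinearMap.sub_apply, sub_eq_zero, Module.algebraMap_end_apply,
      transpEnd_eq_smul]
    have : transpElt n j • (⟨v, hv⟩ : N) = c • ⟨v, hv⟩ := by
      apply e.injective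
      rw [map_smul, hcS, ← algebraMap_smul (MonoidAlgebra ℂ (symSub n j)) c (e _),
        ← algebraMap_smul (MonoidAlgebra ℂ (symSub n j)) c (⟨v, hv⟩ : N), map_smul]
    exact congrArg Subtype.val this
  refine ⟨c, ?_⟩
  rintro _ ⟨v, hv, rfl⟩
  have := hle hv
  rw [LinearMap.mem_ker, LinearMap.sub_apply, sub_eq_zero, Module.algebraMap_end_apply] at this
  exact this

theorem permRep_mem_of_mem_isotypicSpaces {j : ℕ} {C : Submodule ℂ (FunSpace n k)}
    (hC : C ∈ isotypicSpaces n k j) {σ : Perm (Fin n)} (hσ : σ ∈ symSub n j) {f : FunSpace n k}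
    (hf : f ∈ C) : permRep n k σ f ∈ C := by
  obtain ⟨D, -, rfl⟩ := hC
  obtain ⟨v, hv, rfl⟩ := hf
  refine ⟨MonoidAlgebra.of ℂ (symSub n j) ⟨σ, hσ⟩ • v, D.smul_mem _ hv, ?_⟩
  change (subRep n k j).asAlgebraHom _ v = _
  rw [Representation.asAlgebraHom_of]
  rfl

/-- An invariant subspace is the sum of its intersections with the isotypic components. -/
theorem le_iSup_inf_isotypicSpaces {j : ℕ} {M : Submodule ℂ (FunSpace n k)}
    (hM : ∀ σ ∈ symSub n j, ∀ f ∈ M, permRep n k σ f ∈ M) :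
    M ≤ ⨆ C ∈ isotypicSpaces n k j, M ⊓ C := by
  let N : Submodule (MonoidAlgebra ℂ (symSub n j)) (subRep n k j).asModule :=
    MonoidAlgebra.submoduleOfSMulMem
      (M.comap (subRep n k j).asModuleEquiv.toLinearMap) fun g v hv => by
        change (subRep n k j).asAlgebraHom _ v ∈ M
        rw [Representation.asAlgebraHom_of]
        exact hM g g.2 v hv
  -- By semisimplicity N is the sum of its simple submodules, and each of these lies in its own
  -- isotypic component.
  have hN : N ≤ ⨆ S : {S : Submodule (MonoidAlgebra ℂ (symSub n j)) (subRep n k j).asModule //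
      IsSimpleModule (MonoidAlgebra ℂ (symSub n j)) S ∧ S ≤ N}, S.1 := by
    refine (IsSemisimpleModule.sSup_simples_le N).ge.trans (sSup_le fun S hS => ?_)
    exact le_iSup_of_le ⟨S, hS⟩ le_rfl
  intro f hf
  have hfN : (subRep n k j).asModuleEquiv.symm f ∈ N := hf
  refine Submodule.iSup_induction _
    (motive := fun v => (subRep n k j).asModuleEquiv v ∈ ⨆ C ∈ isotypicSpaces n k j, M ⊓ C)
    (hN hfN) ?_ (Submodule.zero_mem _) fun u v hu hv => Submodule.add_mem _ hu hv
  rintro ⟨S, hS, hSN⟩ v hv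
  refine Submodule.mem_iSup_of_mem _ (Submodule.mem_iSup_of_mem ⟨_, ⟨S, hS, rfl⟩, rfl⟩ ?_)
  exact ⟨hSN hv, v, S.le_isotypicComponent hv, rfl⟩

/-- An invariant subspace of `S_i` is the sum of its intersections with the intersections of
isotypic components under `S_1, …, S_i`. -/
theorem le_iSup_inf_iInf_isotypicSpaces (i : ℕ) {M : Submodule ℂ (FunSpace n k)}
    (hM : ∀ σ ∈ symSub n i, ∀ f ∈ M, permRep n k σ f ∈ M) :
    M ≤ ⨆ C : {C : ℕ → Submodule ℂ (FunSpace n k) //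
      ∀ j ∈ Finset.Icc 1 i, C j ∈ isotypicSpaces n k j}, M ⊓ ⨅ j ∈ Finset.Icc 1 i, C.1 j := by
  induction i generalizing M with
  | zero => exact le_iSup_of_le ⟨fun _ => ⊥, by simp⟩ (by simp)
  | succ i ih =>
    refine (le_iSup_inf_isotypicSpaces hM).trans (iSup₂_le fun D hD => ?_)
    -- Since S_i is contained in S_(i+1), the piece cut out by the component D stays invariant under
    -- S_i.
    refine (ih (M := M ⊓ D) fun σ hσ f hf => ⟨hM σ (symSub_mono (Nat.le_succ i) hσ) f hf.1,
      permRep_mem_of_mem_isotypicSpaces hD (symSub_mono (Nat.le_succ i) hσ) hf.2⟩).trans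
      (iSup_le fun C => ?_)
    refine le_iSup_of_le ⟨Function.update C.1 (i + 1) D, fun j hj => ?_⟩ ?_
    · rw [Finset.mem_Icc] at hj
      by_cases h : j = i + 1
      · subst h
        rwa [Function.update_self]
      · rw [Function.update_of_ne h]
        exact C.2 j (Finset.mem_Icc.2 ⟨hj.1, by omega⟩)
    · refine le_inf (inf_le_left.trans inf_le_left) (le_iInf₂ fun j hj => ?_)
      rw [Finset.mem_Icc] at hj
      change _ ≤ Function.update C.1 (i + 1) D j
      by_cases h : j = i + 1
      · rw [h, Function.update_self]
        exact inf_le_left.trans inf_le_right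
      · rw [Function.update_of_ne h]
        exact inf_le_right.trans (iInf₂_le j (Finset.mem_Icc.2 ⟨hj.1, by omega⟩))

theorem permRep_mem_suffixSpace {i : ℕ} {w : Finset (Fin n)} {σ : Perm (Fin n)}
    (hσ : σ ∈ symSub n i) {f : FunSpace n k} (hf : f ∈ suffixSpace n k i w) :
    permRep n k σ f ∈ suffixSpace n k i w := by
  rw [mem_suffixSpace] at hf ⊢
  intro x hx m hm
  rw [← hf _ hx m hm]
  have : m ∈ σ⁻¹ • x ↔ σ • m ∈ x := by
    rw [← Set.powersetCard.mem_coe_iff, ← Set.powersetCard.mem_coe_iff,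
      Set.powersetCard.coe_smul, Finset.mem_inv_smul_finset_iff]
  rw [this, Perm.smul_def, mem_symSub.1 hσ m hm]

/-- The spaces that define the intermediate bases consist of joint eigenvectors. -/
theorem exists_gtSpace_le_jointSpace {i : ℕ} {C : ℕ → Submodule ℂ (FunSpace n k)}
    (hC : ∀ j ∈ Finset.Icc 1 i, C j ∈ isotypicSpaces n k j) (w : Finset (Fin n)) :
    ∃ c : ℕ → ℂ, gtSpace n k i C w ≤ jointSpace n k i i c w := by
  have h (j : ℕ) : ∃ c : ℂ, j ∈ Finset.Icc 1 i → ∀ f ∈ C j, transpSum ℂ n k j f = c • f := by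
    by_cases hj : j ∈ Finset.Icc 1 i
    · obtain ⟨c, hc⟩ := exists_eigenvalue_of_mem_isotypicSpaces (hC j hj)
      exact ⟨c, fun _ => hc⟩
    · exact ⟨0, fun h => absurd h hj⟩
  choose c hc using h
  refine ⟨c, fun f hf => mem_jointSpace.2 ⟨fun l hl hli => ?_, hf.2⟩⟩
  have hl' := Finset.mem_Icc.2 ⟨hl, hli⟩
  exact hc l hl' f ((iInf₂_le l hl' : _ ≤ C l) hf.1)

theorem inner_eq_zero_of_eigenvalue_ne {j : ℕ} {c d : ℂ} (hcd : c ≠ d) {f g : FunSpace n k}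
    (hf : transpSum ℂ n k j f = c • f) (hg : transpSum ℂ n k j g = d • g) :
    inner ℂ f g = 0 :=
  (transpSum_isSymmetric j).orthogonalFamily_eigenspaces.pairwise hcd.symm
    (Module.End.mem_eigenspace_iff.2 hg) f (Module.End.mem_eigenspace_iff.2 hf)

theorem finrank_gtSpace_le_one {i : ℕ} (hi : i ≤ n) {C : ℕ → Submodule ℂ (FunSpace n k)}
    (hC : ∀ j ∈ Finset.Icc 1 i, C j ∈ isotypicSpaces n k j) (w : Finset (Fin n)) :
    Module.finrank ℂ (gtSpace n k i C w) ≤ 1 := by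
  obtain ⟨c, hc⟩ := exists_gtSpace_le_jointSpace hC w
  exact (Submodule.finrank_mono hc).trans (finrank_jointSpace_le_one hi c w)

/-- A joint eigenvector of the sums of transpositions lies in one of the spaces that
define the intermediate bases. -/
theorem exists_mem_gtSpace {i : ℕ} (hi : i ≤ n) {c : ℕ → ℂ} {w : Finset (Fin n)}
    {v : FunSpace n k} (hv : v ∈ jointSpace n k i i c w) (hv0 : v ≠ 0) :
    ∃ C : ℕ → Submodule ℂ (FunSpace n k),
      (∀ j ∈ Finset.Icc 1 i, C j ∈ isotypicSpaces n k j) ∧ v ∈ gtSpace n k i C w := by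
  by_contra! hno
  -- The invariant space of words ending like w is a sum of spaces `gtSpace`. One with different
  -- eigenvalues is orthogonal to v; one with the same eigenvalues lies in the line of v, so it is
  -- zero or contains v. If none contains v, then v is orthogonal to a space in which it lies.
  have hle : suffixSpace n k i w ≤ (ℂ ∙ v)ᗮ := by
    refine (le_iSup_inf_iInf_isotypicSpaces i
      fun σ hσ f hf => permRep_mem_suffixSpace hσ hf).trans (iSup_le ?_)
    rintro ⟨C, hC⟩ u hu
    rw [Submodule.mem_orthogonal_singleton_iff_inner_right]
    have hu' : u ∈ gtSpace n k i C w := hu.symm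
    obtain ⟨d, hd⟩ := exists_gtSpace_le_jointSpace hC w
    by_cases hcd : ∀ l, 1 ≤ l → l ≤ i → c l = d l
    · have huc : u ∈ jointSpace n k i i c w := mem_jointSpace.2
        ⟨fun l hl hli => by rw [hcd l hl hli]; exact (mem_jointSpace.1 (hd hu')).1 l hl hli, hu.1⟩
      by_cases hu0 : u = 0
      · rw [hu0, inner_zero_right]
      · have hu0' : (⟨u, huc⟩ : jointSpace n k i i c w) ≠ 0 :=
          fun h => hu0 (congrArg Subtype.val h)
        have h1 : Module.finrank ℂ (jointSpace n k i i c w) = 1 :=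
          le_antisymm (finrank_jointSpace_le_one hi c w)
            (Module.finrank_pos_iff_exists_ne_zero.2 ⟨_, hu0'⟩)
        obtain ⟨a, ha⟩ := (finrank_eq_one_iff_of_nonzero' _ hu0').1 h1 ⟨v, hv⟩
        have ha' : a • u = v := congrArg Subtype.val ha
        exact absurd (ha' ▸ Submodule.smul_mem _ a hu') (hno C hC)
    · push Not at hcd
      obtain ⟨l, hl, hli, hne⟩ := hcd
      exact inner_eq_zero_of_eigenvalue_ne hne ((mem_jointSpace.1 hv).1 l hl hli)
        ((mem_jointSpace.1 (hd hu')).1 l hl hli)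
  have := Submodule.mem_orthogonal_singleton_iff_inner_right.1 (hle (mem_jointSpace.1 hv).2)
  exact hv0 (inner_self_eq_zero.1 this)

/-- From here on representation theory is no longer needed: only eigenvalues and letters matter. -/
theorem isGTBasis_iff {i : ℕ} (hi : i ≤ n)
    (b : OrthonormalBasis (KSet n k) ℂ (FunSpace n k)) :
    IsGTBasis n k i b ↔ ∀ x, ∃ c : ℕ → ℂ, ∃ w, b x ∈ jointSpace n k i i c w := by
  refine forall_congr' fun x => ⟨?_, ?_⟩
  · rintro ⟨C, w, hC, hx⟩
    obtain ⟨c, hc⟩ := exists_gtSpace_le_jointSpace hC w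
    exact ⟨c, w, hc hx⟩
  · rintro ⟨c, w, hx⟩
    obtain ⟨C, hC, hx'⟩ := exists_mem_gtSpace hi hx (b.orthonormal.ne_zero x)
    exact ⟨C, w, hC, hx'⟩

end Isotypic

/-! ### Simultaneous diagonalization -/

section JointDiagonalization

/-- Commuting symmetric operators have a common orthonormal basis of eigenvectors. -/
theorem exists_orthonormalBasis_joint_eigenvectors {𝕜 E ι κ : Type*} [RCLike 𝕜]
    [NormedAddCommGroup E] [InnerProductSpace 𝕜 E] [FiniteDimensional 𝕜 E] [Fintype κ]
    (hκ : Module.finrank 𝕜 E = Fintype.card κ) {T : ι → Module.End 𝕜 E}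
    (hT : ∀ i, (T i).IsSymmetric) (hC : Pairwise (Function.onFun Commute T)) :
    ∃ b : OrthonormalBasis κ 𝕜 E, ∀ x, ∃ χ : ι → 𝕜, ∀ i, T i (b x) = χ i • b x := by
  classical
  let V (χ : ι → 𝕜) : Submodule 𝕜 E := ⨅ i, Module.End.eigenspace (T i) (χ i)
  have hV : DirectSum.IsInternal V :=
    LinearMap.IsSymmetric.directSum_isInternal_of_pairwise_commute hT hC
  have hO : OrthogonalFamily 𝕜 (fun χ => V χ) fun χ => (V χ).subtypeₗᵢ :=
    LinearMap.IsSymmetric.orthogonalFamily_iInf_eigenspaces hT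
  -- The subordinate basis needs a finite family of subspaces, so the zero eigenspaces are dropped.
  have hfin : {χ | V χ ≠ ⊥}.Finite :=
    WellFoundedGT.finite_ne_bot_of_iSupIndep hV.submodule_iSupIndep
  have : Fintype {χ // V χ ≠ ⊥} := hfin.fintype
  have hV' := DirectSum.isInternal_ne_bot_iff.2 hV
  have hO' := hO.comp (Subtype.val_injective (p := fun χ => V χ ≠ ⊥))
  let b := hV'.subordinateOrthonormalBasis hκ hO'
  refine ⟨b.reindex (Fintype.equivFin κ).symm, fun x => ?_⟩
  rw [OrthonormalBasis.reindex_apply, Equiv.symm_symm]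
  have hb := hV'.subordinateOrthonormalBasis_subordinate hκ (Fintype.equivFin κ x) hO'
  refine ⟨_, fun i => Module.End.mem_eigenspace_iff.1 ((Submodule.mem_iInf _).1 hb i)⟩

end JointDiagonalization

/-! ### Real bases and existence of the chain -/

section Existence

variable {n k : ℕ}

/-- The complex function with the values of a real function. -/
noncomputable def ofRealFun (f : EuclideanSpace ℝ (KSet n k)) : FunSpace n k :=
  WithLp.toLp 2 fun x => (f x : ℂ)

theorem ofRealFun_apply (f : EuclideanSpace ℝ (KSet n k)) (x : KSet n k) :
    ofRealFun f x = (f x : ℂ) := rfl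

theorem inner_ofRealFun (f g : EuclideanSpace ℝ (KSet n k)) :
    inner ℂ (ofRealFun f) (ofRealFun g) = ((inner ℝ f g : ℝ) : ℂ) := by
  simp [PiLp.inner_apply, ofRealFun_apply]

theorem transpSum_ofRealFun (j : ℕ) (f : EuclideanSpace ℝ (KSet n k)) :
    transpSum ℂ n k j (ofRealFun f) = ofRealFun (transpSum ℝ n k j f) := by
  ext x
  simp [transpSum_apply, ofRealFun_apply]

theorem orthonormal_ofRealFun (b : OrthonormalBasis (KSet n k) ℝ (EuclideanSpace ℝ (KSet n k))) :
    Orthonormal ℂ fun x => ofRealFun (b x) := by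
  rw [orthonormal_iff_ite]
  intro x y
  rw [inner_ofRealFun, orthonormal_iff_ite.1 b.orthonormal]
  split_ifs <;> simp

/-- A real orthonormal basis as a complex orthonormal basis. -/
noncomputable def complexBasis
    (b : OrthonormalBasis (KSet n k) ℝ (EuclideanSpace ℝ (KSet n k))) :
    OrthonormalBasis (KSet n k) ℂ (FunSpace n k) :=
  OrthonormalBasis.mk (orthonormal_ofRealFun b)
    ((orthonormal_ofRealFun b).linearIndependent.span_eq_top_of_card_eq_finrank'
      finrank_euclideanSpace.symm).ge

theorem complexBasis_apply (b : OrthonormalBasis (KSet n k) ℝ (EuclideanSpace ℝ (KSet n k)))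
    (x : KSet n k) : complexBasis b x = ofRealFun (b x) := by
  rw [complexBasis, OrthonormalBasis.coe_mk]

theorem complexBasis_basisFun :
    complexBasis (EuclideanSpace.basisFun (KSet n k) ℝ) = deltaBasis n k := by
  refine DFunLike.ext _ _ fun x => ?_
  ext y
  rw [complexBasis_apply, ofRealFun_apply, deltaBasis, EuclideanSpace.basisFun_apply,
    EuclideanSpace.basisFun_apply, PiLp.single_apply, PiLp.single_apply]
  split_ifs <;> simp

theorem exists_real_isGTBasis {i : ℕ} (hi : i ≤ n) :
    ∃ b : OrthonormalBasis (KSet n k) ℝ (EuclideanSpace ℝ (KSet n k)),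
      IsGTBasis n k i (complexBasis b) := by
  -- One operator per place: the first i places carry the groups S_1, …, S_i, the others their
  -- letters.
  let T (m : Fin n) : Module.End ℝ (EuclideanSpace ℝ (KSet n k)) :=
    if (m : ℕ) < i then transpSum ℝ n k (m + 1) else letterProj ℝ n k m
  have hT (m : Fin n) : (T m).IsSymmetric := by
    by_cases hm : (m : ℕ) < i
    · simp only [T, if_pos hm]
      exact transpSum_isSymmetric _
    · simp only [T, if_neg hm]
      exact letterProj_isSymmetric _
  have hC : Pairwise (Function.onFun Commute T) := by
    intro m m' _
    by_cases hm : (m : ℕ) < i <;> by_cases hm' : (m' : ℕ) < i <;>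
      simp only [Function.onFun, T, hm, hm', if_true, if_false]
    · exact transpSum_commute _ _
    · exact transpSum_commute_letterProj (by omega)
    · exact (transpSum_commute_letterProj (by omega)).symm
    · exact letterProj_commute _ _
  obtain ⟨b, hb⟩ := exists_orthonormalBasis_joint_eigenvectors
    (κ := KSet n k) finrank_euclideanSpace hT hC
  refine ⟨b, (isGTBasis_iff hi _).2 fun x => ?_⟩
  obtain ⟨χ, hχ⟩ := hb x
  -- The group S_l belongs to the place l - 1. After place i the eigenvalue of a letter projection
  -- is 1 exactly when the letter is 1; the places before i in this set are irrelevant.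
  refine ⟨fun l => if h : l - 1 < n then (χ ⟨l - 1, h⟩ : ℂ) else 0,
    Finset.univ.filter fun m => χ m = 1, mem_jointSpace.2 ⟨fun l hl hli => ?_, ?_⟩⟩
  · have hln : l - 1 < n := by omega
    have := hχ ⟨l - 1, hln⟩
    simp only [T] at this
    rw [if_pos (by omega), Nat.sub_add_cancel hl] at this
    rw [complexBasis_apply, transpSum_ofRealFun, this, dif_pos hln]
    ext y
    simp [ofRealFun_apply]
  · refine mem_suffixSpace.2 fun y hy m hm => ?_
    rw [complexBasis_apply, ofRealFun_apply, Complex.ofReal_ne_zero] at hy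
    have := congrArg (fun f : EuclideanSpace ℝ (KSet n k) => f y) (hχ m)
    simp only [T, if_neg hm.not_gt, letterProj_apply, PiLp.smul_apply, smul_eq_mul] at this
    rw [Finset.mem_filter, and_iff_right (Finset.mem_univ _)]
    split_ifs at this with hmy
    · refine iff_of_true hmy (mul_right_cancel₀ hy ?_)
      rw [← this, one_mul]
    · refine iff_of_false hmy fun h => ?_
      rw [h, one_mul] at this
      exact hy this.symm

theorem isGTBasis_one_deltaBasis (hn : 1 ≤ n) : IsGTBasis n k 1 (deltaBasis n k) := by
  rw [isGTBasis_iff hn]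
  -- For S_1 only the trivial pair (0, 0) contributes, so the transposition sum is the identity.
  refine fun x => ⟨fun _ => 1, x, mem_jointSpace.2 ⟨fun l hl hl1 => ?_,
    Submodule.subset_span ⟨x, fun m _ => Iff.rfl, rfl⟩⟩⟩
  obtain rfl : l = 1 := le_antisymm hl1 hl
  have hlow : low n 1 = {⟨0, hn⟩} := by
    ext m
    rw [mem_low, Finset.mem_singleton, Fin.ext_iff]
    exact Nat.lt_one_iff
  ext y
  rw [transpSum_apply, hlow, Finset.sum_singleton, Finset.sum_singleton, swap_self, one_smul]
  change deltaBasis n k x ((1 : Perm (Fin n)) • y) = _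
  rw [one_smul]

theorem changeMatrix_apply (b b' : OrthonormalBasis (KSet n k) ℂ (FunSpace n k))
    (x y : KSet n k) : changeMatrix b b' x y = inner ℂ (b' x) (b y) := by
  rw [changeMatrix, Module.Basis.toMatrix_apply, OrthonormalBasis.coe_toBasis_repr_apply,
    OrthonormalBasis.repr_apply_apply]

theorem exists_orthogonal_changeMatrix_complexBasis
    (b b' : OrthonormalBasis (KSet n k) ℝ (EuclideanSpace ℝ (KSet n k))) :
    ∃ Q ∈ Matrix.orthogonalGroup (KSet n k) ℝ,
      changeMatrix (complexBasis b) (complexBasis b') = Q.map Complex.ofReal := by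
  refine ⟨b'.toBasis.toMatrix b, b'.toMatrix_orthonormalBasis_mem_orthogonal b, ?_⟩
  ext x y
  rw [changeMatrix_apply, complexBasis_apply, complexBasis_apply, inner_ofRealFun,
    Matrix.map_apply, Module.Basis.toMatrix_apply, OrthonormalBasis.coe_toBasis_repr_apply,
    OrthonormalBasis.repr_apply_apply]

theorem exists_isBasisChain_real (hn : 1 ≤ n) :
    ∃ b : ℕ → OrthonormalBasis (KSet n k) ℝ (EuclideanSpace ℝ (KSet n k)),
      IsBasisChain n k fun i => complexBasis (b i) := by
  have h (i : ℕ) : ∃ b : OrthonormalBasis (KSet n k) ℝ (EuclideanSpace ℝ (KSet n k)),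
      (i ≤ 1 → complexBasis b = deltaBasis n k) ∧
        (1 ≤ i → i ≤ n → IsGTBasis n k i (complexBasis b)) := by
    by_cases hi : i ≤ 1
    · refine ⟨EuclideanSpace.basisFun _ ℝ, fun _ => complexBasis_basisFun, fun h1 _ => ?_⟩
      obtain rfl : i = 1 := le_antisymm hi h1
      rw [complexBasis_basisFun]
      exact isGTBasis_one_deltaBasis hn
    · by_cases hin : i ≤ n
      · obtain ⟨b, hb⟩ := exists_real_isGTBasis (k := k) hin
        exact ⟨b, fun h => absurd h hi, fun _ _ => hb⟩
      · exact ⟨EuclideanSpace.basisFun _ ℝ, fun h => absurd h hi, fun _ h => absurd h hin⟩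
  choose b hb using h
  exact ⟨b, (hb 0).1 zero_le_one, ((hb 1).1 le_rfl).trans ((hb 0).1 zero_le_one).symm,
    fun i => (hb i).2⟩

end Existence

/-! ### Factorization and sparsity -/

section Factors

variable {n k : ℕ}

theorem changeMatrix_mul (b b' b'' : OrthonormalBasis (KSet n k) ℂ (FunSpace n k)) :
    changeMatrix b' b'' * changeMatrix b b' = changeMatrix b b'' := by
  simpa [changeMatrix] using
    Module.Basis.toMatrix_mul_toMatrix b''.toBasis b'.toBasis (b : KSet n k → FunSpace n k)

theorem changeMatrix_self (b : OrthonormalBasis (KSet n k) ℂ (FunSpace n k)) :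
    changeMatrix b b = 1 := by
  simpa [changeMatrix] using Module.Basis.toMatrix_self b.toBasis

/-- The product telescopes. The factor applied first stands on the right, hence the reversal of the
list. -/
theorem changeMatrix_eq_prod (B : ℕ → OrthonormalBasis (KSet n k) ℂ (FunSpace n k)) (m : ℕ) :
    changeMatrix (B 1) (B (m + 1)) =
      ((List.range m).map fun i => changeMatrix (B (i + 1)) (B (i + 2))).reverse.prod := by
  induction m with
  | zero => simpa using changeMatrix_self (B 1)
  | succ m ih =>
    rw [List.range_succ, List.map_append, List.reverse_append, List.prod_append, ← ih]
    simp [changeMatrix_mul]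

/-- The factors have at most two nonzero entries in each column. -/
theorem ncard_changeMatrix_ne_zero_le_two {i : ℕ} (hi : i < n)
    {b b' : OrthonormalBasis (KSet n k) ℂ (FunSpace n k)} (hb : IsGTBasis n k i b)
    (hb' : IsGTBasis n k (i + 1) b') (y : KSet n k) :
    {x | changeMatrix b b' x y ≠ 0}.ncard ≤ 2 := by
  classical
  obtain ⟨c, w, hy⟩ := (isGTBasis_iff hi.le b).1 hb y
  have hmem (x : KSet n k) (hx : changeMatrix b b' x y ≠ 0) :
      b' x ∈ jointSpace n k (i + 1) i c w := by
    rw [changeMatrix_apply] at hx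
    obtain ⟨d, v, hxd⟩ := (isGTBasis_iff hi b').1 hb' x
    rw [mem_jointSpace] at hxd hy ⊢
    refine ⟨fun l hl hli => ?_, ?_⟩
    · have hdc : d l = c l := by
        by_contra hne
        exact hx (inner_eq_zero_of_eigenvalue_ne hne (hxd.1 l hl (by omega)) (hy.1 l hl hli))
      rw [← hdc, hxd.1 l hl (by omega)]
    -- A nonzero inner product gives a word z in both supports; through z the fixed letters after
    -- place i + 1 are the same for both vectors.
    · obtain ⟨z, hz⟩ : ∃ z, b' x z ≠ 0 ∧ b y z ≠ 0 := by
        by_contra! h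
        refine hx ?_
        rw [PiLp.inner_apply]
        refine Finset.sum_eq_zero fun z _ => ?_
        by_cases h' : b' x z = 0
        · rw [h', inner_zero_left]
        · rw [h z h', inner_zero_right]
      refine mem_suffixSpace.2 fun u hu m hm => ?_
      rw [mem_suffixSpace.1 hxd.2 u hu m hm, ← mem_suffixSpace.1 hxd.2 z hz.1 m hm,
        mem_suffixSpace.1 hy.2 z hz.2 m (by omega)]
  let v (x : {x | changeMatrix b b' x y ≠ 0}) : jointSpace n k (i + 1) i c w :=
    ⟨b' x, hmem x x.2⟩
  have hv : LinearIndependent ℂ v := by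
    refine LinearIndependent.of_comp (Submodule.subtype _) ?_
    exact b'.orthonormal.linearIndependent.comp _ Subtype.val_injective
  rw [← Nat.card_coe_set_eq, Nat.card_eq_fintype_card]
  exact hv.fintype_card_le_finrank.trans (finrank_jointSpace_succ_le_two hi c w)

theorem card_KSet (n k : ℕ) : Fintype.card (KSet n k) = n.choose k := by
  rw [← Nat.card_eq_fintype_card, Set.powersetCard.card, Nat.card_fin]

theorem card_support_le_of_columns {ι : Type*} [Fintype ι] [DecidableEq ι] (M : Matrix ι ι ℂ)
    {d : ℕ} (hM : ∀ y, {x | M x y ≠ 0}.ncard ≤ d) :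
    (Finset.univ.filter fun q : ι × ι => M q.1 q.2 ≠ 0).card ≤ d * Fintype.card ι := by
  have h := Finset.card_le_mul_card_image_of_maps_to (f := Prod.snd) (t := Finset.univ)
    (s := Finset.univ.filter fun q : ι × ι => M q.1 q.2 ≠ 0) (fun _ _ => Finset.mem_univ _) d ?_
  · rwa [Finset.card_univ] at h
  · intro y _
    refine le_trans ?_ (hM y)
    rw [← Set.ncard_coe_finset]
    refine Set.ncard_le_ncard_of_injOn Prod.fst ?_ ?_ (Set.toFinite _)
    · rintro ⟨x, y'⟩ h
      simp only [Finset.coe_filter, Finset.mem_filter, Finset.mem_univ, true_and,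
        Set.mem_ofPred_eq] at h ⊢
      rw [← h.2]
      exact h.1
    · rintro ⟨x, y₁⟩ h₁ ⟨x', y₂⟩ h₂ hxx
      simp only [Finset.coe_filter, Finset.mem_filter, Finset.mem_univ, true_and,
        Set.mem_ofPred_eq] at h₁ h₂ hxx
      rw [hxx, h₁.2, h₂.2]

end Factors

/-! ### Operation count -/

section Straightline

theorem Computation.zero_mem {ι : Type} {A : Set ℂ} {m : ℕ} {S : Set ((ι → ℂ) → ℂ)}
    (h : Computation A m S) : (fun _ => 0) ∈ S := by
  induction h with
  | start => exact Set.mem_insert _ _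
  | mulAdd _ _ _ _ ih => exact Set.mem_insert_of_mem _ ih

/-- A sum of products over a set of positions of a matrix takes one operation per position. -/
theorem Computation.exists_partial_mulVec {ι : Type} [DecidableEq ι] {A : Set ℂ} {m : ℕ}
    {S : Set ((ι → ℂ) → ℂ)} (h : Computation A m S) {M : Matrix ι ι ℂ} (hM : ∀ x y, M x y ∈ A)
    {U : ι → (ι → ℂ) → ℂ} (hU : ∀ y, U y ∈ S) (P : Finset (ι × ι)) :
    ∃ S', Computation A (m + P.card) S' ∧ S ⊆ S' ∧
      ∀ x, (fun a => ∑ q ∈ P with q.1 = x, M q.1 q.2 * U q.2 a) ∈ S' := by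
  induction P using Finset.induction_on with
  | empty => exact ⟨S, h, subset_rfl, fun x => by simpa using h.zero_mem⟩
  | insert q P hq ih =>
    obtain ⟨S', hS', hSS', hP⟩ := ih
    -- One operation adds the new product to the partial sum of the row `q.1`; the other rows are
    -- unchanged.
    refine ⟨insert (fun a => M q.1 q.2 * U q.2 a +
      ∑ r ∈ P with r.1 = q.1, M r.1 r.2 * U r.2 a) S', ?_, ?_, fun x => ?_⟩
    · rw [Finset.card_insert_of_notMem hq, ← add_assoc]
      exact hS'.mulAdd (hM q.1 q.2) (hSS' (hU q.2)) (hP q.1)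
    · exact hSS'.trans (Set.subset_insert _ _)
    · rw [Finset.filter_insert]
      split_ifs with hx
      · left
        subst hx
        ext a
        rw [Finset.sum_insert fun hmem => hq (Finset.mem_filter.1 hmem).1]
      · exact Set.mem_insert_of_mem _ (hP x)

/-- A multiplication by a matrix with at most `d` nonzero entries in each column takes at most `d`
operations per column. -/
theorem Computation.exists_mulVec {ι : Type} [Fintype ι] [DecidableEq ι] {A : Set ℂ} {m : ℕ}
    {S : Set ((ι → ℂ) → ℂ)} (h : Computation A m S) {M : Matrix ι ι ℂ} (hM : ∀ x y, M x y ∈ A)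
    {d : ℕ} (hd : ∀ y, {x | M x y ≠ 0}.ncard ≤ d)
    {U : ι → (ι → ℂ) → ℂ} (hU : ∀ y, U y ∈ S) :
    ∃ m' ≤ m + d * Fintype.card ι, ∃ S', Computation A m' S' ∧
      ∀ x, (fun a => ∑ y, M x y * U y a) ∈ S' := by
  obtain ⟨S', hS', -, hP⟩ :=
    h.exists_partial_mulVec hM hU (Finset.univ.filter fun q : ι × ι => M q.1 q.2 ≠ 0)
  refine ⟨_, Nat.add_le_add_left (card_support_le_of_columns M hd) m, S', hS', fun x => ?_⟩
  convert hP x using 2 with a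
  rw [Finset.filter_filter, Finset.sum_filter, Fintype.sum_prod_type]
  symm
  refine (Finset.sum_eq_single x (fun x' _ hx' => by simp [hx'])
    fun hx => absurd (Finset.mem_univ x) hx).trans (Finset.sum_congr rfl fun y _ => ?_)
  by_cases hxy : M x y = 0 <;> simp [hxy]

variable {n k : ℕ}

theorem repr_eq_sum_changeMatrix (b b' : OrthonormalBasis (KSet n k) ℂ (FunSpace n k))
    (f : FunSpace n k) (x : KSet n k) :
    b'.repr f x = ∑ y, changeMatrix b b' x y * b.repr f y := by
  have := congrFun (Module.Basis.toMatrix_mulVec_repr b.toBasis b'.toBasis f) x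
  simpa [Matrix.mulVec, dotProduct, changeMatrix] using this.symm

/-- The transform from `B 1` to `B (j + 1)` takes at most `2 j (n choose k)` operations. -/
theorem exists_computation {B : ℕ → OrthonormalBasis (KSet n k) ℂ (FunSpace n k)}
    (hB : IsBasisChain n k B) {j : ℕ} (hj : j + 1 ≤ n) :
    ∃ m ≤ 2 * j * n.choose k, ∃ S : Set ((KSet n k → ℂ) → ℂ),
      Computation {c | ∃ i, 1 ≤ i ∧ i < n ∧ ∃ x y, c = changeMatrix (B i) (B (i + 1)) x y} m S ∧
      ∀ x, ∃ g ∈ S, ∀ f : FunSpace n k,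
        g (fun y => (B 0).repr f y) = (B (j + 1)).repr f x := by
  induction j with
  | zero =>
    refine ⟨0, by simp, _, Computation.start, fun x => ⟨fun a => a x, ?_, fun f => ?_⟩⟩
    · exact Set.mem_insert_of_mem _ ⟨x, rfl⟩
    -- No operation is spent here because B 1 = B 0, which leaves n - 1 factors instead of n.
    · rw [zero_add, hB.one]
  | succ j ih =>
    obtain ⟨m, hm, S, hS, hg⟩ := ih (by omega)
    choose U hU hUf using hg
    obtain ⟨m', hm', S', hS', hS''⟩ := hS.exists_mulVec
      (M := changeMatrix (B (j + 1)) (B (j + 2))) (d := 2)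
      (fun x y => ⟨j + 1, by omega, by omega, x, y, rfl⟩)
      (ncard_changeMatrix_ne_zero_le_two (by omega) (hB.gt (j + 1) (by omega) (by omega))
        (hB.gt (j + 2) (by omega) hj)) hU
    refine ⟨m', ?_, S', hS', fun x => ⟨_, hS'' x, fun f => ?_⟩⟩
    · rw [card_KSet] at hm'
      refine hm'.trans ((Nat.add_le_add_right hm _).trans_eq ?_)
      ring
    · simp only [hUf]
      exact (repr_eq_sum_changeMatrix _ _ f x).symm

end Straightline

end JohnsonFFT

theorem mainTheorem1 (n k : ℕ) (hn : 1 ≤ n) (hk : k ≤ n) :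
    -- the spaces that define the bases are lines or zero: the bases are unique up to scalars
    (∀ i ≤ n, ∀ (C : ℕ → Submodule ℂ (JohnsonFFT.FunSpace n k)) (w : Finset (Fin n)),
      (∀ j ∈ Finset.Icc 1 i, C j ∈ JohnsonFFT.isotypicSpaces n k j) →
        Module.finrank ℂ (JohnsonFFT.gtSpace n k i C w) ≤ 1) ∧
    -- the bases exist, and with a suitable choice of scalars the factors are real orthogonal
    (∃ B : ℕ → OrthonormalBasis (JohnsonFFT.KSet n k) ℂ (JohnsonFFT.FunSpace n k),
      JohnsonFFT.IsBasisChain n k B ∧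
      ∀ i, 1 ≤ i → i < n → ∃ Q ∈ Matrix.orthogonalGroup (JohnsonFFT.KSet n k) ℝ,
        JohnsonFFT.changeMatrix (B i) (B (i + 1)) = Q.map Complex.ofReal) ∧
    -- for every choice of the bases:
    (∀ B : ℕ → OrthonormalBasis (JohnsonFFT.KSet n k) ℂ (JohnsonFFT.FunSpace n k),
      JohnsonFFT.IsBasisChain n k B →
      -- the factorization `[B 0]_{B n} = [B (n-1)]_{B n} ⋯ [B 1]_{B 2}`
      JohnsonFFT.changeMatrix (B 0) (B n) =
        ((List.range (n - 1)).map fun i =>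
          JohnsonFFT.changeMatrix (B (i + 1)) (B (i + 2))).reverse.prod ∧
      -- the factors are unitary, with at most two nonzero entries in each column
      (∀ i, 1 ≤ i → i < n →
        JohnsonFFT.changeMatrix (B i) (B (i + 1)) ∈
            Matrix.unitaryGroup (JohnsonFFT.KSet n k) ℂ ∧
        ∀ y, {x | JohnsonFFT.changeMatrix (B i) (B (i + 1)) x y ≠ 0}.ncard ≤ 2) ∧
      -- the Fourier transform takes at most `2 (n - 1) (n choose k)` operations, with the entries
      -- of the factors as the only constants
      ∃ m ≤ 2 * (n - 1) * n.choose k, ∃ S : Set ((JohnsonFFT.KSet n k → ℂ) → ℂ),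
        JohnsonFFT.Computation
          {c | ∃ i, 1 ≤ i ∧ i < n ∧ ∃ x y, c = JohnsonFFT.changeMatrix (B i) (B (i + 1)) x y} m S ∧
        ∀ x, ∃ g ∈ S, ∀ f : JohnsonFFT.FunSpace n k,
          g (fun y => (B 0).repr f y) = (B n).repr f x) := by
  refine ⟨fun i hi C w hC => JohnsonFFT.finrank_gtSpace_le_one hi hC w, ?_, fun B hB => ?_⟩
  · obtain ⟨b, hb⟩ := JohnsonFFT.exists_isBasisChain_real (k := k) hn
    exact ⟨_, hb, fun i _ _ =>
      JohnsonFFT.exists_orthogonal_changeMatrix_complexBasis (b i) (b (i + 1))⟩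
  · obtain ⟨m, rfl⟩ : ∃ m, n = m + 1 := ⟨n - 1, by omega⟩
    refine ⟨?_, fun i hi hin => ⟨?_, fun y => ?_⟩, ?_⟩
    · rw [← hB.one]
      exact JohnsonFFT.changeMatrix_eq_prod B m
    · exact (B (i + 1)).toMatrix_orthonormalBasis_mem_unitary (B i)
    · exact JohnsonFFT.ncard_changeMatrix_ne_zero_le_two hin (hB.gt i hi hin.le)
        (hB.gt (i + 1) (by omega) hin) y
    · exact JohnsonFFT.exists_computation hB le_rfl
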